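/- \textbf{Theorem (Reeb vector fields).} Let $M$ be a finite-dimensional smooth manifold (without boundary), let $k\ge 0$ be an integer, and let $\eta^1,\dots,\eta^k\in\Omega^1(M)$ be smooth differential $1$-forms. Put $$\mathcal D^{\mathrm C}=\bigcap_{\alpha=1}^k\ker\eta^\alpha\subset \mathrm TM,\qquad \mathcal D^{\mathrm R}=\bigcap_{\alpha=1}^k\{v\in \mathrm TM : i(v)\,\mathrm d\eta^\alpha=0\}\subset \mathrm TM$$ ($\mathcal D^{\mathrm R}$ is called the Reeb distribution; an empty intersection is $\mathrm TM$). Call a family of vector subspaces $D_x\subset \mathrm T_xM$, $x\in M$, a regular distribution if it is smooth, i.e. locally spanned by a family of smooth vector fields, and has locally constant rank. Assume that $(\eta^\alpha)$ is a $k$-contact structure on $M$, that is: (i) $\mathcal D^{\mathrm C}$ is a regular distribution of corank $k$; (ii) $\mathcal D^{\mathrm R}$ is a regular distribution of rank $k$; (iii) $\mathcal D^{\mathrm C}\cap\mathcal D^{\mathrm R}=\{0\}$. Then there exist smooth global vector fields $\mathcal R_1,\dots,\mathcal R_k\in\mathfrak X(M)$ such that $$i(\mathcal R_\beta)\eta^\alpha=\delta^\alpha_{\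 \beta},\qquad i(\mathcal R_\beta)\,\mathrm d\eta^\alpha=0\qquad(1\le\alpha,\beta\le k),$$ and they are uniquely determined by these relations. Moreover $[\mathcal R_\alpha,\mathcal R_\beta]=0$ for all $\alpha,\beta$, and $\mathcal D^{\mathrm R}=\langle\mathcal R_1,\dots,\mathcal R_k\rangle$, i.e. $\mathcal R_1(x),\dots,\mathcal R_k(x)$ span $\mathcal D^{\mathrm R}_x$ at every $x\in M$. -/

import Mathlib

open Bundle
open scoped Manifold ContDiff

noncomputable section

namespace KContact

variable {E : Type*} [NormedAddCommGroup E] [NormedSpace ℝ E]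
  {H : Type*} [TopologicalSpace H] (I : ModelWithCorners ℝ E H)
  (M : Type*) [TopologicalSpace M] [ChartedSpace H M] [IsManifold I ∞ M]

/-- `𝔛(M)`: smooth global vector fields on `M`, i.e. smooth sections of the tangent bundle. -/
abbrev SmoothVectorField : Type _ :=
  ContMDiffSection I E ∞ (TangentSpace I : M → Type _)

/-- `Ω¹(M)`: smooth differential 1-forms on `M`, i.e. smooth sections of the cotangent bundle
(the bundle of continuous linear maps from the tangent bundle to the trivial line bundle). -/
abbrev OneForm : Type _ :=
  ContMDiffSection I (E →L[ℝ] ℝ) ∞ (fun x : M ↦ TangentSpace I x →L[ℝ] Trivial M ℝ x)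

variable {I M}

/-- The value `η x` of a 1-form, as a linear functional on `T_x M`. -/
def OneForm.at (η : OneForm I M) (x : M) : TangentSpace I x →L[ℝ] ℝ := η x

/-- The local representative of a 1-form in the preferred chart at `x₀`: its pullback by the
inverse of that chart, as a 1-form on the model vector space `E`. -/
def OneForm.inChart (η : OneForm I M) (x₀ : M) (u : E) : E [⋀^Fin 1]→L[ℝ] ℝ :=
  ContinuousAlternatingMap.ofSubsingleton ℝ E ℝ (0 : Fin 1)
    ((η.at ((extChartAt I x₀).symm u)).comp
      (mfderivWithin 𝓘(ℝ, E) I (extChartAt I x₀).symm (Set.range I) u))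

/-- The exterior derivative `dη` of a 1-form at `x`: the exterior derivative of the local
representative in the chart at `x`, pulled back to `T_x M` by the derivative of the chart. It is
normalized by `dη(X, Y) = X(η(Y)) - Y(η(X)) - η([X, Y])`. -/
def OneForm.extDeriv (η : OneForm I M) (x : M) : TangentSpace I x [⋀^Fin 2]→L[ℝ] ℝ :=
  (extDerivWithin (η.inChart x) (Set.range I) (extChartAt I x x)).compContinuousLinearMap
    (mfderiv I 𝓘(ℝ, E) (extChartAt I x) x)

/-- The morphism `τ̂ : T_x M → T_x^* M`, `v ↦ i(v)τ`, induced by a 2-form at `x` (a linear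
functional is written as an alternating form of degree one). -/
def contraction {x : M} (τ : TangentSpace I x [⋀^Fin 2]→L[ℝ] ℝ) :
    TangentSpace I x →ₗ[ℝ] (TangentSpace I x [⋀^Fin 1]→ₗ[ℝ] ℝ) :=
  τ.toAlternatingMap.curryLeft

variable (I M) in
/-- A (generalized) distribution on `M`: a vector subspace of each tangent space. -/
abbrev Distribution : Type _ := ∀ x : M, Submodule ℝ (TangentSpace I x)

/-- A distribution is smooth when it is locally spanned by a family of smooth vector fields. -/
def Distribution.IsSmooth (D : Distribution I M) : Prop :=
  ∀ x : M, ∃ U : Set M, IsOpen U ∧ x ∈ U ∧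
    ∃ 𝒳 : Set (∀ y : M, TangentSpace I y),
      (∀ X ∈ 𝒳, ContMDiffOn I I.tangent ∞ (fun y ↦ (⟨y, X y⟩ : TangentBundle I M)) U) ∧
      ∀ y ∈ U, D y = Submodule.span ℝ ((fun X ↦ X y) '' 𝒳)

/-- A distribution is regular when it is smooth and of locally constant rank. -/
def Distribution.IsRegular (D : Distribution I M) : Prop :=
  D.IsSmooth ∧ IsLocallyConstant (fun x : M ↦ Module.finrank ℝ (D x))

variable {k : ℕ}

/-- The contact distribution `D^C = ⋂_α ker η^α`. -/
def contactDistribution (η : Fin k → OneForm I M) : Distribution I M :=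
  fun x ↦ ⨅ α, LinearMap.ker ((η α).at x).toLinearMap

/-- The Reeb distribution `D^R = ⋂_α ker (dη^α)^`. -/
def reebDistribution (η : Fin k → OneForm I M) : Distribution I M :=
  fun x ↦ ⨅ α, LinearMap.ker (contraction ((η α).extDeriv x))

/-- A `k`-contact structure on `M`. -/
structure IsKContactStructure (η : Fin k → OneForm I M) : Prop where
  /-- `D^C` is a regular distribution of corank `k`. -/
  contact_regular : (contactDistribution η).IsRegular
  contact_corank : ∀ x : M, Module.finrank ℝ (TangentSpace I x ⧸ contactDistribution η x) = k
  /-- `D^R` is a regular distribution of rank `k`. -/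
  reeb_regular : (reebDistribution η).IsRegular
  reeb_rank : ∀ x : M, Module.finrank ℝ (reebDistribution η x) = k
  /-- `D^C ∩ D^R = {0}`. -/
  inter_eq_bot : ∀ x : M, contactDistribution η x ⊓ reebDistribution η x = ⊥

/-- The relations `i(R_β)η^α = δ^α_β` and `i(R_β)dη^α = 0`. -/
def ReebRelations (η : Fin k → OneForm I M) (R : Fin k → SmoothVectorField I M) : Prop :=
  ∀ α β : Fin k, ∀ x : M,
    (η α).at x (R β x) = (if α = β then 1 else 0) ∧ contraction ((η α).extDeriv x) (R β x) = 0

end KContact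

end

/-!
At each point `x` the map `v ↦ (η^α(v))_α` from the Reeb subspace `D^R_x` to `ℝ^k` is injective,
since its kernel is `D^C_x ∩ D^R_x = 0`, and hence bijective, since `D^R_x` has dimension `k`
(`IsKContactStructure.reebEval_bijective`). The Reeb vectors at `x` are the preimages of the
standard basis; they are the only solutions of the defining relations and a basis of `D^R_x`.

For smoothness near `x`, extend the Reeb vectors at `x` to local smooth sections `Y_γ` of the smooth
distribution `D^R`. The matrix `A = (η^α(Y_γ))` is smooth and is the identity at `x`, so it is
invertible near `x`, and there `R_β = ∑_γ (A⁻¹)_{γβ} Y_γ`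
(`IsKContactStructure.contMDiff_reebVector`). No choice is involved in `R_β` itself, so these local
descriptions need no gluing.

For the brackets, let `V` and `W` be vector fields with `η(V)`, `η(W)` constant and `i(V)dη = 0`,
`i(W)dη = 0`. Cartan's formula for `dη(V, W)` gives `η([V, W]) = 0`, and the one for
`d(dη)(V, W, v) = 0` gives `dη([V, W], v) = 0`
(`OneForm.at_mlieBracket_eq_zero_and_contraction_eq_zero`). So the brackets of Reeb fields lie in
`D^C ∩ D^R = 0`. The computation takes place in the chart at one point, while `dη` at a point is
defined through the chart at that very point; the two are compared by
`OneForm.extDeriv_eq_of_mem_source`, the invariance of `d` under change of charts.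
-/

namespace KContact

open VectorField Filter Set

/-! ### Contraction of a 2-form with a vector -/

section Contraction

variable {E : Type*} [NormedAddCommGroup E] [NormedSpace ℝ E]
  {H : Type*} [TopologicalSpace H] {I : ModelWithCorners ℝ E H}
  {M : Type*} [TopologicalSpace M] [ChartedSpace H M]

theorem contraction_apply {x : M} (τ : TangentSpace I x [⋀^Fin 2]→L[ℝ] ℝ)
    (v : TangentSpace I x) (w : Fin 1 → TangentSpace I x) :
    contraction τ v w = τ (Matrix.vecCons v w) := rfl

theorem contraction_eq_zero_iff {x : M} {τ : TangentSpace I x [⋀^Fin 2]→L[ℝ] ℝ}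
    {v : TangentSpace I x} : contraction τ v = 0 ↔ ∀ w, τ ![v, w] = 0 := by
  refine ⟨fun h w ↦ ?_, fun h ↦ ?_⟩
  · rw [← contraction_apply, h]; rfl
  · ext w
    rw [contraction_apply]
    have : w = ![w 0] := by ext i; fin_cases i; rfl
    rw [this]; exact h _

end Contraction

/-! ### Smooth matrix-valued functions -/

section Matrix

variable {E : Type*} [NormedAddCommGroup E] [NormedSpace ℝ E]
  {H : Type*} [TopologicalSpace H] {I : ModelWithCorners ℝ E H}
  {M : Type*} [TopologicalSpace M] [ChartedSpace H M]

theorem contMDiffAt_det {n : Type*} [Fintype n] [DecidableEq n] {A : M → Matrix n n ℝ} {x : M}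
    (hA : ∀ i j, ContMDiffAt I 𝓘(ℝ, ℝ) ∞ (fun y ↦ A y i j) x) :
    ContMDiffAt I 𝓘(ℝ, ℝ) ∞ (fun y ↦ (A y).det) x := by
  simp only [Matrix.det_apply, Units.smul_def, zsmul_eq_mul]
  refine contMDiffAt_finsetSum fun σ _ ↦ ?_
  refine contMDiffAt_const.mul ?_
  exact contMDiffAt_finsetProd fun i _ ↦ hA _ _

theorem contMDiffAt_inv {n : Type*} [Fintype n] [DecidableEq n] {A : M → Matrix n n ℝ} {x : M}
    (hA : ∀ i j, ContMDiffAt I 𝓘(ℝ, ℝ) ∞ (fun y ↦ A y i j) x) (h : (A x).det ≠ 0) (i j : n) :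
    ContMDiffAt I 𝓘(ℝ, ℝ) ∞ (fun y ↦ (A y)⁻¹ i j) x := by
  simp only [Matrix.inv_def, Matrix.smul_apply, Ring.inverse_eq_inv', smul_eq_mul,
    Matrix.adjugate_apply]
  refine ((contMDiffAt_det hA).inv₀ h).mul (contMDiffAt_det fun a b ↦ ?_)
  by_cases hab : a = j
  · simp only [Matrix.updateRow_apply, hab, if_true]; exact contMDiffAt_const
  · simpa only [Matrix.updateRow_apply, hab, if_false] using hA a b

end Matrix

/-! ### Exterior derivatives and Lie brackets on a vector space -/

section VectorSpace

variable {E : Type*} [NormedAddCommGroup E] [NormedSpace ℝ E]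
  {θ : E → E [⋀^Fin 1]→L[ℝ] ℝ} {A B : E → E} {u : E}

/-- Cartan's formula for the exterior derivative of a 1-form. -/
theorem extDeriv_one_apply_vectorField (hθ : DifferentiableAt ℝ θ u)
    (hA : DifferentiableAt ℝ A u) (hB : DifferentiableAt ℝ B u) :
    extDeriv θ u ![A u, B u] = fderiv ℝ (fun w ↦ θ w ![B w]) u (A u) -
      fderiv ℝ (fun w ↦ θ w ![A w]) u (B u) - θ u ![lieBracket ℝ A B u] := by
  have h := extDeriv_apply_vectorField (V := ![A, B]) hθ (by simp [Fin.forall_fin_two, hA, hB])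
  have e : (fun i ↦ (![A, B] : Fin 2 → E → E) i u) = ![A u, B u] := by
    ext i; fin_cases i <;> rfl
  rw [e] at h
  have e0 : ∀ w, Fin.removeNth 0 (fun i ↦ (![A, B] : Fin 2 → E → E) i w) = ![B w] := fun w ↦ by
    ext i; fin_cases i; rfl
  have e1 : ∀ w, Fin.removeNth 1 (fun i ↦ (![A, B] : Fin 2 → E → E) i w) = ![A w] := fun w ↦ by
    ext i; fin_cases i; rfl
  have e2 : ∀ z : Fin 0 → E, Matrix.vecCons (lieBracket ℝ A B u) z = ![lieBracket ℝ A B u] :=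
    fun z ↦ by ext i; fin_cases i; rfl
  rw [h]
  simp only [Nat.reduceAdd, Fin.sum_univ_two, e0, e1]
  simp [e2, sub_eq_add_neg]

/-- Cartan's formula for the exterior derivative of a 2-form. -/
theorem extDeriv_two_apply_vectorField {τ : E → E [⋀^Fin 2]→L[ℝ] ℝ} {C : E → E}
    (hτ : DifferentiableAt ℝ τ u) (hA : DifferentiableAt ℝ A u) (hB : DifferentiableAt ℝ B u)
    (hC : DifferentiableAt ℝ C u) :
    extDeriv τ u ![A u, B u, C u] = fderiv ℝ (fun w ↦ τ w ![B w, C w]) u (A u) -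
      fderiv ℝ (fun w ↦ τ w ![A w, C w]) u (B u) + fderiv ℝ (fun w ↦ τ w ![A w, B w]) u (C u) -
      τ u ![lieBracket ℝ A B u, C u] + τ u ![lieBracket ℝ A C u, B u] -
      τ u ![lieBracket ℝ B C u, A u] := by
  have h := extDeriv_apply_vectorField (V := ![A, B, C]) hτ
    (by intro i; fin_cases i <;> simpa)
  have e : (fun i ↦ (![A, B, C] : Fin 3 → E → E) i u) = ![A u, B u, C u] := by
    ext i; fin_cases i <;> rfl
  have e0 : ∀ w, Fin.removeNth 0 (fun i ↦ (![A, B, C] : Fin 3 → E → E) i w) = ![B w, C w] :=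
    fun w ↦ by ext i; fin_cases i <;> rfl
  have e1 : ∀ w, Fin.removeNth 1 (fun i ↦ (![A, B, C] : Fin 3 → E → E) i w) = ![A w, C w] :=
    fun w ↦ by ext i; fin_cases i <;> rfl
  have e2 : ∀ w, Fin.removeNth 2 (fun i ↦ (![A, B, C] : Fin 3 → E → E) i w) = ![A w, B w] :=
    fun w ↦ by ext i; fin_cases i <;> rfl
  have s0 : Finset.Ici (0 : Fin 2) = {0, 1} := by decide
  have s1 : Finset.Ici (1 : Fin 2) = {1} := by decide
  have f0 : Fin.removeNth 0 (Fin.removeNth (Fin.castSucc 0) ![A u, B u, C u]) = ![C u] := by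
    ext i; fin_cases i; rfl
  have f1 : Fin.removeNth 1 (Fin.removeNth (Fin.castSucc 0) ![A u, B u, C u]) = ![B u] := by
    ext i; fin_cases i; rfl
  have f2 : Fin.removeNth 1 (Fin.removeNth (Fin.castSucc 1) ![A u, B u, C u]) = ![A u] := by
    ext i; fin_cases i; rfl
  rw [e] at h
  rw [h]
  refine (congrArg₂ (· - ·) (Fin.sum_univ_three _) (Fin.sum_univ_two _)).trans ?_
  simp only [e0, e1, e2, s0, s1, f0, f1, f2, Finset.sum_singleton,
    Finset.sum_pair (zero_ne_one' (Fin 2))]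
  simp
  ring

theorem differentiableAt_extDeriv (hθ : ContDiffAt ℝ 2 θ u) :
    DifferentiableAt ℝ (extDeriv θ) u := by
  have h : DifferentiableAt ℝ (fderiv ℝ θ) u :=
    (hθ.fderiv_right (m := 1) (by norm_num)).differentiableAt one_ne_zero
  exact (ContinuousAlternatingMap.alternatizeUncurryFinCLM ℝ E ℝ).differentiableAt.comp u h

theorem alternating_swap (τ : E [⋀^Fin 2]→L[ℝ] ℝ) (v w : E) : τ ![v, w] = - τ ![w, v] := by
  have h := τ.map_swap ![w, v] (i := 0) (j := 1) (by decide)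
  refine Eq.trans ?_ h
  change τ _ = τ _
  congr 1
  ext i; fin_cases i <;> rfl

/-- Vector fields annihilating `dθ` are closed under the bracket: in Cartan's formula for
`d(dθ)(A, B, v) = 0` every term but `dθ([A, B], v)` contains `A` or `B` as an argument of `dθ`. -/
theorem extDeriv_apply_lieBracket_eq_zero (hθ : ContDiffAt ℝ 2 θ u)
    (hA : DifferentiableAt ℝ A u) (hB : DifferentiableAt ℝ B u)
    (hdA : ∀ᶠ w in nhds u, ∀ v, extDeriv θ w ![A w, v] = 0)
    (hdB : ∀ᶠ w in nhds u, ∀ v, extDeriv θ w ![B w, v] = 0) (v : E) :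
    extDeriv θ u ![lieBracket ℝ A B u, v] = 0 := by
  have h := extDeriv_two_apply_vectorField (C := fun _ ↦ v) (differentiableAt_extDeriv hθ) hA hB
    (differentiableAt_const v)
  have h1 : (fun w ↦ extDeriv θ w ![B w, v]) =ᶠ[nhds u] fun _ ↦ 0 := by
    filter_upwards [hdB] with w hw using hw v
  have h2 : (fun w ↦ extDeriv θ w ![A w, v]) =ᶠ[nhds u] fun _ ↦ 0 := by
    filter_upwards [hdA] with w hw using hw v
  have h3 : (fun w ↦ extDeriv θ w ![A w, B w]) =ᶠ[nhds u] fun _ ↦ 0 := by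
    filter_upwards [hdA] with w hw using hw _
  rw [extDeriv_extDeriv_apply hθ (by simp), h1.fderiv_eq, h2.fderiv_eq, h3.fderiv_eq,
    alternating_swap _ _ (B u), hdB.self_of_nhds, alternating_swap _ _ (A u),
    hdA.self_of_nhds] at h
  simpa using h.symm

/-- If `θ(A)` and `θ(B)` are locally constant, Cartan's formula reads `dθ(A, B) = -θ([A, B])`. -/
theorem apply_lieBracket_eq_zero {a b : ℝ} (hθ : DifferentiableAt ℝ θ u)
    (hA : DifferentiableAt ℝ A u) (hB : DifferentiableAt ℝ B u)
    (hcA : ∀ᶠ w in nhds u, θ w ![A w] = a) (hcB : ∀ᶠ w in nhds u, θ w ![B w] = b)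
    (hd : extDeriv θ u ![A u, B u] = 0) : θ u ![lieBracket ℝ A B u] = 0 := by
  have h := extDeriv_one_apply_vectorField hθ hA hB
  have h1 : (fun w ↦ θ w ![A w]) =ᶠ[nhds u] fun _ ↦ a := hcA
  have h2 : (fun w ↦ θ w ![B w]) =ᶠ[nhds u] fun _ ↦ b := hcB
  rw [hd, h1.fderiv_eq, h2.fderiv_eq] at h
  simpa using h.symm

end VectorSpace

variable {E : Type*} [NormedAddCommGroup E] [NormedSpace ℝ E]
  {H : Type*} [TopologicalSpace H] {I : ModelWithCorners ℝ E H}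
  {M : Type*} [TopologicalSpace M] [ChartedSpace H M] [IsManifold I ∞ M] {k : ℕ}

/-! ### Pointwise description of the two distributions -/

theorem mem_contactDistribution {η : Fin k → OneForm I M} {x : M} {v : TangentSpace I x} :
    v ∈ contactDistribution η x ↔ ∀ α, (η α).at x v = 0 := by
  simp [contactDistribution]

theorem mem_reebDistribution {η : Fin k → OneForm I M} {x : M} {v : TangentSpace I x} :
    v ∈ reebDistribution η x ↔ ∀ α, contraction ((η α).extDeriv x) v = 0 := by
  simp [reebDistribution]

/-- `v ↦ (η^α(v))_α` on the Reeb subspace at `x`. -/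
noncomputable def reebEval (η : Fin k → OneForm I M) (x : M) :
    reebDistribution η x →ₗ[ℝ] (Fin k → ℝ) :=
  LinearMap.pi fun α ↦ ((η α).at x).toLinearMap.comp (reebDistribution η x).subtype

/-! ### Smooth sections -/

theorem OneForm.contMDiffAt_apply (η : OneForm I M) {x : M} {Y : ∀ y : M, TangentSpace I y}
    (hY : ContMDiffAt I I.tangent ∞ (fun y ↦ (⟨y, Y y⟩ : TangentBundle I M)) x) :
    ContMDiffAt I 𝓘(ℝ, ℝ) ∞ (fun y ↦ η.at y (Y y)) x := by
  have h := ContMDiffAt.clm_bundle_apply (F₁ := E) (F₂ := ℝ) (E₂ := Trivial M ℝ) (b := id)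
    (ϕ := fun y ↦ η y) (η.contMDiff x) hY
  exact (Bundle.contMDiffAt_section x).1 h

/-- A vector in a smooth distribution extends to a local smooth section of the distribution. -/
theorem Distribution.IsSmooth.exists_section {D : Distribution I M} (hD : D.IsSmooth) {x : M}
    {v : TangentSpace I x} (hv : v ∈ D x) :
    ∃ Y : ∀ y : M, TangentSpace I y, Y x = v ∧ (∀ᶠ y in nhds x, Y y ∈ D y) ∧
      ContMDiffAt I I.tangent ∞ (fun y ↦ (⟨y, Y y⟩ : TangentBundle I M)) x := by
  obtain ⟨U, hU, hxU, 𝒳, h𝒳, hspan⟩ := hD x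
  have hUx : U ∈ nhds x := hU.mem_nhds hxU
  rw [hspan x hxU] at hv
  induction hv using Submodule.span_induction with
  | mem v hv =>
    obtain ⟨X, hX, rfl⟩ := hv
    refine ⟨X, rfl, ?_, (h𝒳 X hX).contMDiffAt hUx⟩
    filter_upwards [hUx] with y hy
    rw [hspan y hy]
    exact Submodule.subset_span ⟨X, hX, rfl⟩
  | zero =>
    exact ⟨0, rfl, .of_forall fun y ↦ (D y).zero_mem, contMDiff_zeroSection ℝ _ x⟩
  | add v w _ _ hv hw =>
    obtain ⟨Y, rfl, hYD, hY⟩ := hv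
    obtain ⟨Z, rfl, hZD, hZ⟩ := hw
    refine ⟨Y + Z, rfl, ?_, hY.add_section hZ⟩
    filter_upwards [hYD, hZD] with y h₁ h₂ using (D y).add_mem h₁ h₂
  | smul c v _ hv =>
    obtain ⟨Y, rfl, hYD, hY⟩ := hv
    refine ⟨c • Y, rfl, ?_, hY.const_smul_section⟩
    filter_upwards [hYD] with y h₁ using (D y).smul_mem c h₁

/-! ### The Reeb vector fields -/

namespace IsKContactStructure

variable {η : Fin k → OneForm I M}

/-- A vector of the Reeb distribution is determined by its values under the forms `η^α`, because
`D^C ∩ D^R = 0`. -/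
theorem eq_of_forall_eq (hη : IsKContactStructure η) {x : M} {v w : TangentSpace I x}
    (hv : v ∈ reebDistribution η x) (hw : w ∈ reebDistribution η x)
    (h : ∀ α, (η α).at x v = (η α).at x w) : v = w := by
  rw [← sub_eq_zero, ← Submodule.mem_bot ℝ, ← hη.inter_eq_bot x]
  refine ⟨mem_contactDistribution.2 fun α ↦ ?_, Submodule.sub_mem _ hv hw⟩
  rw [map_sub, h, sub_self]

theorem reebEval_injective (hη : IsKContactStructure η) (x : M) :
    Function.Injective (reebEval η x) := fun v w h ↦
  Subtype.ext <| hη.eq_of_forall_eq v.2 w.2 fun α ↦ congrFun h α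

variable [FiniteDimensional ℝ E]

theorem reebEval_bijective (hη : IsKContactStructure η) (x : M) :
    Function.Bijective (reebEval η x) := by
  have : FiniteDimensional ℝ (TangentSpace I x) := inferInstanceAs (FiniteDimensional ℝ E)
  refine ⟨hη.reebEval_injective x, ?_⟩
  refine (LinearMap.injective_iff_surjective_of_finrank_eq_finrank ?_).1 (hη.reebEval_injective x)
  rw [hη.reeb_rank x, Module.finrank_fin_fun]

/-- The value at `x` of the `β`-th Reeb vector field: the vector of the Reeb subspace on which `η^α`
takes the value `δ^α_β`. -/
noncomputable def reebVector (hη : IsKContactStructure η) (β : Fin k) (x : M) :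
    TangentSpace I x :=
  (LinearEquiv.ofBijective (reebEval η x) (hη.reebEval_bijective x)).symm (Pi.single β 1)

theorem reebVector_mem (hη : IsKContactStructure η) (β : Fin k) (x : M) :
    hη.reebVector β x ∈ reebDistribution η x :=
  Subtype.coe_prop _

theorem at_reebVector (hη : IsKContactStructure η) (α β : Fin k) (x : M) :
    (η α).at x (hη.reebVector β x) = if α = β then 1 else 0 := by
  have h := (LinearEquiv.ofBijective (reebEval η x) (hη.reebEval_bijective x)).apply_symm_apply
    (Pi.single β 1)
  rw [← Pi.single_apply]
  exact congrFun h α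

theorem eq_sum_reebVector (hη : IsKContactStructure η) {x : M} {v : TangentSpace I x}
    (hv : v ∈ reebDistribution η x) : v = ∑ β, (η β).at x v • hη.reebVector β x := by
  refine hη.eq_of_forall_eq hv (Submodule.sum_mem _ fun β _ ↦
    Submodule.smul_mem _ _ (hη.reebVector_mem β x)) fun α ↦ ?_
  simp [map_sum, hη.at_reebVector]

theorem span_reebVector (hη : IsKContactStructure η) (x : M) :
    reebDistribution η x = Submodule.span ℝ (Set.range fun β ↦ hη.reebVector β x) := by
  refine le_antisymm (fun v hv ↦ ?_) (Submodule.span_le.2 ?_)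
  · rw [hη.eq_sum_reebVector hv]
    exact Submodule.sum_mem _ fun β _ ↦ Submodule.smul_mem _ _ (Submodule.subset_span ⟨β, rfl⟩)
  · rintro _ ⟨β, rfl⟩
    exact hη.reebVector_mem β x

theorem contMDiff_reebVector (hη : IsKContactStructure η) (β : Fin k) :
    ContMDiff I I.tangent ∞ (fun y ↦ (⟨y, hη.reebVector β y⟩ : TangentBundle I M)) := by
  intro x
  -- Only the values of the `Y γ` at `x` are those of the Reeb fields.
  choose Y hYx hYD hY using fun γ ↦ hη.reeb_regular.1.exists_section (hη.reebVector_mem γ x)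
  let A : M → Matrix (Fin k) (Fin k) ℝ := fun y ↦ .of fun α γ ↦ (η α).at y (Y γ y)
  have hA : ∀ α γ, ContMDiffAt I 𝓘(ℝ, ℝ) ∞ (fun y ↦ A y α γ) x := fun α γ ↦
    (η α).contMDiffAt_apply (hY γ)
  have hAx : A x = 1 := by
    ext α γ
    simp only [A, Matrix.of_apply, hYx, hη.at_reebVector, Matrix.one_apply]
  have hdet : (A x).det ≠ 0 := by simp [hAx]
  have hsum : ContMDiffAt I I.tangent ∞
      (fun y ↦ (⟨y, ∑ γ, (A y)⁻¹ γ β • Y γ y⟩ : TangentBundle I M)) x :=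
    ContMDiffAt.sum_section fun γ _ ↦ (contMDiffAt_inv hA hdet γ β).smul_section (hY γ)
  refine hsum.congr_of_eventuallyEq ?_
  filter_upwards [Filter.eventually_all.2 hYD,
    (contMDiffAt_det hA).continuousAt.eventually_ne hdet] with y hyD hydet
  congr 1
  refine hη.eq_of_forall_eq (hη.reebVector_mem β y) (Submodule.sum_mem _ fun γ _ ↦
    Submodule.smul_mem _ _ (hyD γ)) fun α ↦ ?_
  -- Entry `(α, β)` of `A * A⁻¹ = 1`.
  have h := congrFun (congrFun (Matrix.mul_nonsing_inv (A y) hydet.isUnit) α) β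
  rw [Matrix.mul_apply, Matrix.one_apply] at h
  rw [hη.at_reebVector, ← h, map_sum]
  simp [A, mul_comm]

end IsKContactStructure

/-! ### Forms and vector fields in a chart -/

/-- The representative of `η` in the chart at `x₀` pulls back to `η` under that chart. -/
theorem OneForm.inChart_mfderiv (η : OneForm I M) {x₀ z : M}
    (hz : z ∈ (extChartAt I x₀).source) (v : TangentSpace I z) :
    η.inChart x₀ (extChartAt I x₀ z) ![mfderiv I 𝓘(ℝ, E) (extChartAt I x₀) z v] = η.at z v := by
  have h := mfderivWithin_extChartAt_symm_comp_mfderiv_extChartAt' (I := I) hz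
  have h' := DFunLike.congr_fun h v
  -- The fibres over `φ⁻¹(φ(z))` and `z` are identified by comparing vectors in `E`.
  have key : ∀ p : M, p = z → ∀ v w : E, v = w → (η.at p : E → ℝ) v = (η.at z : E → ℝ) w := by
    rintro _ rfl _ _ rfl; rfl
  exact key _ ((extChartAt I x₀).left_inv hz) _ _ h'

/-- The vector field on the model space representing `V` in the preferred chart at `x₀`, with
values in `E`. Its values outside the target of the chart are irrelevant. -/
noncomputable def fieldInChart (V : ∀ y : M, TangentSpace I y) (x₀ : M) : E → E :=
  mpullbackWithin 𝓘(ℝ, E) I (extChartAt I x₀).symm V (range I)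

theorem fieldInChart_extChartAt {x₀ z : M} (hz : z ∈ (extChartAt I x₀).source)
    (V : ∀ y : M, TangentSpace I y) :
    fieldInChart V x₀ (extChartAt I x₀ z) = mfderiv I 𝓘(ℝ, E) (extChartAt I x₀) z (V z) := by
  have hinv : (mfderivWithin 𝓘(ℝ, E) I (extChartAt I x₀).symm (range I)
      (extChartAt I x₀ z)).inverse = mfderiv I 𝓘(ℝ, E) (extChartAt I x₀) z :=
    ContinuousLinearMap.inverse_eq
      (mfderivWithin_extChartAt_symm_comp_mfderiv_extChartAt' (I := I) hz)
      (mfderiv_extChartAt_comp_mfderivWithin_extChartAt_symm' (I := I) hz)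
  -- The fibres over `φ⁻¹(φ(z))` and `z` are identified by comparing vectors in `E`.
  have key : ∀ p : M, p = z → (V p : E) = V z := by rintro _ rfl; rfl
  have e := key ((extChartAt I x₀).symm (extChartAt I x₀ z)) ((extChartAt I x₀).left_inv hz)
  exact (congrArg (ContinuousLinearMap.inverse (M := E) (M₂ := E) _) e).trans
    (DFunLike.congr_fun hinv (V z))

/-- The bracket on the manifold, read in the chart at the base point, is the bracket of the
representatives. -/
theorem mfderiv_extChartAt_mlieBracket [I.Boundaryless] (V W : ∀ y : M, TangentSpace I y) (x : M) :
    mfderiv I 𝓘(ℝ, E) (extChartAt I x) x (mlieBracket I V W x) =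
      lieBracket ℝ (E := E) (fieldInChart V x) (fieldInChart W x) (extChartAt I x x) := by
  have h : mlieBracket I V W x = (mfderiv I 𝓘(ℝ, E) (extChartAt I x) x).inverse
      (lieBracketWithin ℝ (E := E) (fieldInChart V x) (fieldInChart W x)
        ((extChartAt I x).symm ⁻¹' univ ∩ range I) (extChartAt I x x)) := rfl
  rw [preimage_univ, univ_inter, I.range_eq_univ, lieBracketWithin_univ] at h
  exact ((isInvertible_mfderiv_extChartAt (I := I)
    (mem_extChartAt_source x)).inverse_apply_eq.1 h.symm).symm

theorem eventually_inChart_fieldInChart [I.Boundaryless] (η : OneForm I M)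
    {V : ∀ y : M, TangentSpace I y} {c : ℝ} (hV : ∀ y, η.at y (V y) = c) (x : M) :
    ∀ᶠ u in nhds (extChartAt I x x), η.inChart x u ![fieldInChart V x u] = c := by
  filter_upwards [extChartAt_target_mem_nhds (I := I) x] with u hu
  obtain ⟨z, hz, rfl⟩ : ∃ z ∈ (extChartAt I x).source, extChartAt I x z = u :=
    ⟨_, (extChartAt I x).map_target hu, (extChartAt I x).right_inv hu⟩
  rw [fieldInChart_extChartAt hz]
  exact (η.inChart_mfderiv hz _).trans (hV z)

theorem mdifferentiableAt_extChartAt_of_mem {x₀ z : M} (hz : z ∈ (extChartAt I x₀).source) :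
    MDifferentiableAt I 𝓘(ℝ, E) (extChartAt I x₀) z :=
  mdifferentiableAt_extChartAt (by simpa using hz)

/-- Coordinate vector fields of a chart are smooth on its domain. -/
theorem contMDiffAt_mpullback_const [CompleteSpace E] {x₀ z : M}
    (hz : z ∈ (extChartAt I x₀).source) (v : E) :
    ContMDiffAt I I.tangent ∞
      (fun y ↦ (⟨y, mpullback I 𝓘(ℝ, E) (extChartAt I x₀) (fun _ ↦ v) y⟩ : TangentBundle I M))
      z := by
  -- Pulling back fields costs one derivative; `∞ + 1` is `∞` by definition.
  have : IsManifold I (∞ + 1) M := inferInstanceAs (IsManifold I ∞ M)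
  refine ContMDiffAt.mpullback_vectorField_preimage (n := ∞) (m := ∞) ?_
    (contMDiffAt_extChartAt' (by simpa using hz)) (isInvertible_mfderiv_extChartAt hz) le_rfl
  exact contMDiffAt_vectorSpace_iff_contDiffAt.2 contDiffAt_const

variable [FiniteDimensional ℝ E] [I.Boundaryless]

theorem OneForm.contDiffAt_inChart (η : OneForm I M) {x₀ z : M}
    (hz : z ∈ (extChartAt I x₀).source) :
    ContDiffAt ℝ ∞ (η.inChart x₀) (extChartAt I x₀ z) := by
  have : CompleteSpace E := FiniteDimensional.complete ℝ E
  have hopen : IsOpen (extChartAt I x₀).target := isOpen_extChartAt_target x₀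
  let g : E → E →L[ℝ] ℝ := fun u ↦ ((η.at ((extChartAt I x₀).symm u)).comp
      (mfderivWithin 𝓘(ℝ, E) I (extChartAt I x₀).symm (range I) u))
  -- Linear on a finite-dimensional space, hence smooth.
  let L : (E →L[ℝ] ℝ) →ₗ[ℝ] (E [⋀^Fin 1]→L[ℝ] ℝ) :=
    { toFun := ContinuousAlternatingMap.ofSubsingleton ℝ E ℝ (0 : Fin 1)
      map_add' := fun _ _ ↦ rfl
      map_smul' := fun _ _ ↦ rfl }
  -- As `E` is finite-dimensional, smoothness can be tested on a fixed vector `v`: there `g` is `η`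
  -- applied to a coordinate vector field.
  have hg : ContDiffOn ℝ ∞ g (extChartAt I x₀).target := by
    refine contDiffOn_clm_apply.2 fun v u hu ↦ ContDiffAt.contDiffWithinAt ?_
    let Z : ∀ y : M, TangentSpace I y := mpullback I 𝓘(ℝ, E) (extChartAt I x₀) (fun _ ↦ v)
    have hus := (extChartAt I x₀).map_target hu
    have hZ : ContMDiffAt 𝓘(ℝ, E) 𝓘(ℝ, ℝ) ∞
        ((fun y ↦ η.at y (Z y)) ∘ (extChartAt I x₀).symm) u := by
      refine (η.contMDiffAt_apply (contMDiffAt_mpullback_const hus v)).comp u ?_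
      exact (contMDiffOn_extChartAt_symm x₀).contMDiffAt (hopen.mem_nhds hu)
    refine hZ.contDiffAt.congr_of_eventuallyEq ?_
    filter_upwards [hopen.mem_nhds hu] with w hw
    have hinv : (mfderiv I 𝓘(ℝ, E) (extChartAt I x₀) ((extChartAt I x₀).symm w)).inverse =
        mfderivWithin 𝓘(ℝ, E) I (extChartAt I x₀).symm (range I) w :=
      ContinuousLinearMap.inverse_eq
        (mfderiv_extChartAt_comp_mfderivWithin_extChartAt_symm (I := I) hw)
        (mfderivWithin_extChartAt_symm_comp_mfderiv_extChartAt (I := I) hw)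
    exact congrArg (η.at ((extChartAt I x₀).symm w)) (DFunLike.congr_fun hinv v).symm
  have hgz := (hg.contDiffAt (hopen.mem_nhds ((extChartAt I x₀).map_source hz)))
  exact (LinearMap.toContinuousLinearMap L).contDiff.contDiffAt.comp _ hgz

/-- The exterior derivative can be computed in any chart: `dη` at `y`, defined through the chart at
`y`, is also the pullback of the exterior derivative of the representative in the chart at `x₀`. -/
theorem OneForm.extDeriv_eq_of_mem_source (η : OneForm I M) {x₀ y : M}
    (hy : y ∈ (extChartAt I x₀).source) :
    η.extDeriv y = (_root_.extDeriv (η.inChart x₀) (extChartAt I x₀ y)).compContinuousLinearMap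
      (mfderiv I 𝓘(ℝ, E) (extChartAt I x₀) y) := by
  set φ := extChartAt I x₀
  set φy := extChartAt I y
  set w₀ := φy y
  have hw₀ : w₀ ∈ φy.target := mem_extChartAt_target y
  have hyw : φy.symm w₀ = y := extChartAt_to_inv y
  have hopen : IsOpen φy.target := isOpen_extChartAt_target y
  have hsymm : ∀ w ∈ φy.target, ContMDiffAt 𝓘(ℝ, E) I ∞ φy.symm w := fun w hw ↦
    (contMDiffOn_extChartAt_symm y).contMDiffAt (hopen.mem_nhds hw)
  have hφ : ∀ z ∈ φ.source, ContMDiffAt I 𝓘(ℝ, E) ∞ φ z := fun z hz ↦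
    contMDiffAt_extChartAt' (by simpa [φ] using hz)
  -- The transition map from the chart at `y` to the chart at `x₀`.
  let ψ : E → E := φ ∘ φy.symm
  have hψ : ContDiffAt ℝ ∞ ψ w₀ := by
    refine ContMDiffAt.contDiffAt (ContMDiffAt.comp w₀ (hφ _ ?_) (hsymm w₀ hw₀))
    rwa [hyw]
  have hsrc : ∀ᶠ w in nhds w₀, φy.symm w ∈ φ.source := by
    refine (hsymm w₀ hw₀).continuousAt.eventually_mem ?_
    rw [hyw]
    exact (isOpen_extChartAt_source x₀).mem_nhds hy
  -- The representatives of `η` in the two charts are related by pullback along `ψ`.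
  have hev : η.inChart y =ᶠ[nhds w₀]
      fun w ↦ (η.inChart x₀ (ψ w)).compContinuousLinearMap (fderiv ℝ ψ w) := by
    filter_upwards [hopen.mem_nhds hw₀, hsrc] with w hw hws
    have hchain : mfderiv 𝓘(ℝ, E) 𝓘(ℝ, E) ψ w = (mfderiv I 𝓘(ℝ, E) φ (φy.symm w)).comp
        (mfderiv 𝓘(ℝ, E) I φy.symm w) :=
      mfderiv_comp w ((hφ _ hws).mdifferentiableAt (by simp))
        ((hsymm w hw).mdifferentiableAt (by simp))
    rw [mfderiv_eq_fderiv] at hchain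
    ext v
    have h := η.inChart_mfderiv hws (mfderiv 𝓘(ℝ, E) I φy.symm w (v 0))
    have e : (fderiv ℝ ψ w) ∘ v = ![mfderiv I 𝓘(ℝ, E) φ (φy.symm w)
        (mfderiv 𝓘(ℝ, E) I φy.symm w (v 0))] := by
      ext i; fin_cases i; exact DFunLike.congr_fun hchain (v 0)
    refine Eq.trans ?_ (h.symm.trans (congrArg (η.inChart x₀ (ψ w)) e.symm))
    rw [← mfderivWithin_univ, ← I.range_eq_univ]
    rfl
  have hψy : ψ w₀ = φ y := congrArg φ hyw
  have hpull : _root_.extDeriv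
      (fun w ↦ (η.inChart x₀ (ψ w)).compContinuousLinearMap (fderiv ℝ ψ w)) w₀ =
      (_root_.extDeriv (η.inChart x₀) (ψ w₀)).compContinuousLinearMap (fderiv ℝ ψ w₀) :=
    extDeriv_pullback (r := ∞)
      (by rw [hψy]; exact (η.contDiffAt_inChart hy).differentiableAt (by simp)) hψ
      (by rw [minSmoothness_of_isRCLikeNormedField]; exact ENat.LEInfty.out)
  rw [← hev.extDeriv_eq, hψy] at hpull
  have hchain : mfderiv I 𝓘(ℝ, E) φ y = (fderiv ℝ ψ w₀).comp (mfderiv I 𝓘(ℝ, E) φy y) := by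
    have hc : mfderiv I 𝓘(ℝ, E) (ψ ∘ φy) y = (mfderiv 𝓘(ℝ, E) 𝓘(ℝ, E) ψ w₀).comp
        (mfderiv I 𝓘(ℝ, E) φy y) :=
      mfderiv_comp y ((hψ.contMDiffAt).mdifferentiableAt (by simp))
        (mdifferentiableAt_extChartAt_of_mem (mem_extChartAt_source y))
    rw [mfderiv_eq_fderiv] at hc
    have hcongr : φ =ᶠ[nhds y] ψ ∘ φy := by
      filter_upwards [extChartAt_source_mem_nhds (I := I) y] with z hz
      exact (congrArg φ (φy.left_inv hz)).symm
    exact hcongr.mfderiv_eq.trans hc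
  ext v
  change extDerivWithin (η.inChart y) (range I) w₀ (mfderiv I 𝓘(ℝ, E) φy y ∘ v) = _
  rw [I.range_eq_univ, extDerivWithin_univ, hpull, hchain]
  rfl

/-! ### Brackets of vector fields annihilating the exterior derivative -/

theorem contDiffAt_fieldInChart {V : ∀ y : M, TangentSpace I y} {x : M}
    (hV : ContMDiffAt I I.tangent ∞ (fun y ↦ (⟨y, V y⟩ : TangentBundle I M)) x) :
    ContDiffAt ℝ ∞ (fieldInChart V x) (extChartAt I x x) := by
  have : CompleteSpace E := FiniteDimensional.complete ℝ E
  -- Pulling back fields costs one derivative; `∞ + 1` is `∞` by definition.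
  have : IsManifold I (∞ + 1) M := inferInstanceAs (IsManifold I ∞ M)
  have h := contMDiffWithinAt_mpullbackWithin_extChartAt_symm (n := ∞) (m := ∞) (s := univ)
    hV.contMDiffWithinAt uniqueMDiffOn_univ (mem_univ x) le_rfl
  refine contMDiffAt_vectorSpace_iff_contDiffAt.1 (h.contMDiffAt ?_)
  rw [preimage_univ, inter_univ]
  exact extChartAt_target_mem_nhds x

/-- If `i(V)dη = 0` on `M`, then the same holds for the representatives of `V` and `η` in one
fixed chart, near its base point. -/
theorem eventually_extDeriv_inChart_fieldInChart (η : OneForm I M)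
    {V : ∀ y : M, TangentSpace I y} (hV : ∀ y, contraction (η.extDeriv y) (V y) = 0) (x : M) :
    ∀ᶠ u in nhds (extChartAt I x x), ∀ v,
      _root_.extDeriv (η.inChart x) u ![fieldInChart V x u, v] = 0 := by
  filter_upwards [extChartAt_target_mem_nhds (I := I) x] with u hu v
  obtain ⟨z, hz, rfl⟩ : ∃ z ∈ (extChartAt I x).source, extChartAt I x z = u :=
    ⟨_, (extChartAt I x).map_target hu, (extChartAt I x).right_inv hu⟩
  obtain ⟨w, rfl⟩ := (isInvertible_mfderiv_extChartAt hz).bijective.surjective v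
  have h := contraction_eq_zero_iff.1 (hV z) w
  rw [η.extDeriv_eq_of_mem_source hz] at h
  rw [fieldInChart_extChartAt hz]
  refine Eq.trans (congrArg (_root_.extDeriv (η.inChart x) (extChartAt I x z)) ?_) h
  ext i; fin_cases i <;> rfl

/-- The bracket of two vector fields that annihilate `dη` and on which `η` is constant annihilates
both `η` and `dη`. -/
theorem OneForm.at_mlieBracket_eq_zero_and_contraction_eq_zero {η : OneForm I M}
    {V W : ∀ y : M, TangentSpace I y} {a b : ℝ} {x : M}
    (hV : ContMDiffAt I I.tangent ∞ (fun y ↦ (⟨y, V y⟩ : TangentBundle I M)) x)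
    (hW : ContMDiffAt I I.tangent ∞ (fun y ↦ (⟨y, W y⟩ : TangentBundle I M)) x)
    (hVa : ∀ y, η.at y (V y) = a) (hWb : ∀ y, η.at y (W y) = b)
    (hVd : ∀ y, contraction (η.extDeriv y) (V y) = 0)
    (hWd : ∀ y, contraction (η.extDeriv y) (W y) = 0) :
    η.at x (mlieBracket I V W x) = 0 ∧
      contraction (η.extDeriv x) (mlieBracket I V W x) = 0 := by
  have hx := mem_extChartAt_source (I := I) x
  have hθ := η.contDiffAt_inChart hx
  have hA := (contDiffAt_fieldInChart hV).differentiableAt (by simp)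
  have hB := (contDiffAt_fieldInChart hW).differentiableAt (by simp)
  have hdA := eventually_extDeriv_inChart_fieldInChart η hVd x
  have hdB := eventually_extDeriv_inChart_fieldInChart η hWd x
  constructor
  · rw [← η.inChart_mfderiv hx, mfderiv_extChartAt_mlieBracket]
    exact apply_lieBracket_eq_zero (hθ.differentiableAt (by simp)) hA hB
      (eventually_inChart_fieldInChart η hVa x) (eventually_inChart_fieldInChart η hWb x)
      (hdA.self_of_nhds _)
  · refine contraction_eq_zero_iff.2 fun w ↦ ?_
    rw [η.extDeriv_eq_of_mem_source hx]
    refine Eq.trans (congrArg (_root_.extDeriv (η.inChart x) (extChartAt I x x)) ?_)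
      (extDeriv_apply_lieBracket_eq_zero (hθ.of_le ENat.LEInfty.out) hA hB hdA hdB
        (mfderiv I 𝓘(ℝ, E) (extChartAt I x) x w))
    rw [← mfderiv_extChartAt_mlieBracket]
    ext i; fin_cases i <;> rfl

end KContact

theorem mainTheorem1
    {E : Type*} [NormedAddCommGroup E] [NormedSpace ℝ E] [FiniteDimensional ℝ E]
    {H : Type*} [TopologicalSpace H] (I : ModelWithCorners ℝ E H) [I.Boundaryless]
    (M : Type*) [TopologicalSpace M] [ChartedSpace H M] [IsManifold I ∞ M]
    (k : ℕ) (η : Fin k → KContact.OneForm I M) (hη : KContact.IsKContactStructure η) :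
    ∃ R : Fin k → KContact.SmoothVectorField I M,
      KContact.ReebRelations η R ∧
      (∀ R' : Fin k → KContact.SmoothVectorField I M, KContact.ReebRelations η R' → R' = R) ∧
      (∀ α β : Fin k, ∀ x : M, VectorField.mlieBracket I (R α) (R β) x = 0) ∧
      (∀ x : M, KContact.reebDistribution η x =
        Submodule.span ℝ (Set.range fun α : Fin k ↦ R α x)) := by
  have hd : ∀ α β x, KContact.contraction ((η α).extDeriv x) (hη.reebVector β x) = 0 :=
    fun α β x ↦ KContact.mem_reebDistribution.1 (hη.reebVector_mem β x) α
  refine ⟨fun β ↦ ⟨hη.reebVector β, hη.contMDiff_reebVector β⟩,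
    fun α β x ↦ ⟨hη.at_reebVector α β x, hd α β x⟩, fun R' hR' ↦ ?_, fun α β x ↦ ?_,
    hη.span_reebVector⟩
  · funext β
    ext x
    refine hη.eq_of_forall_eq (KContact.mem_reebDistribution.2 fun α ↦ (hR' α β x).2)
      (hη.reebVector_mem β x) fun α ↦ ?_
    rw [(hR' α β x).1]
    exact (hη.at_reebVector α β x).symm
  · have h := fun γ ↦ KContact.OneForm.at_mlieBracket_eq_zero_and_contraction_eq_zero
      (hη.contMDiff_reebVector α x) (hη.contMDiff_reebVector β x)
      (hη.at_reebVector γ α) (hη.at_reebVector γ β)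
      (hd γ α) (hd γ β)
    rw [← Submodule.mem_bot ℝ, ← hη.inter_eq_bot x]
    exact ⟨KContact.mem_contactDistribution.2 fun γ ↦ (h γ).1,
      KContact.mem_reebDistribution.2 fun γ ↦ (h γ).2⟩
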